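/- Let $T\cong(\mathbb C^*)^r$ be a complex torus with character group $\Lambda\cong\mathbb Z^r$, let $E$ be a finite set, and let $\Delta=\{(a_e,\chi_e)\}_{e\in E}$, with $a_e\in\mathbb C^*$ and $\chi_e\in\Lambda$, be a toric arrangement in $T$ with hypertori $H_e=\{t\in T : 1-a_e\chi_e(t)=0\}$. Its poset of layers $\mathscr S(\Delta)$ is the set of connected components of the intersections $\bigcap_{i\in I}H_i$, $I\subseteq E$, ordered by reverse inclusion. The arrangement $\Delta$ is essential if the characters $\chi_e$ generate a sublattice of maximal rank in $\Lambda$. Let $\mathcal B\subseteq E$ be such that $(\chi_b)_{b\in\mathcal B}$ is a basis of $\Lambda\otimes\mathbb Q$, and let $A=(a_{b,e})_{b\in\mathcal B,\,e\in E\setminus\mathcal B}$ be the rational matrix with $\chi_e=\sum_{b\in\mathcal B}a_{b,e}\chi_b$. Let $\mathcal G$ be the bipartite graph with vertex classes $\mathcal B$ and $E\setminus\mathcal B$ in which $b$ and $e$ are joined if and only if $a_{b,e}\neq0$. If $\mathcal A$ is a maximal forest in $\mathcal G$ (a maximal subgraph without cycles), then $\Delta$ is in normal form with respect to $\mathcal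 B$ and $\mathcal A$ if $a_{b,e}>0$ for every edge $\{b,e\}$ of $\mathcal A$. **Theorem.** Let $\Delta$ be an essential toric arrangement in normal form with respect to a basis $\mathcal B$ and a maximal forest $\mathcal A$. Then the linear relations $\sum_{i\in I}c_im_i\chi_i=0$ among its characters, where $I\subseteq E$, $c_i\in\{\pm1\}$ and the $m_i$ are positive integers with $\gcd_{i\in I}(m_i)=1$, are uniquely determined by the poset of layers $\mathscr S(\Delta)$ over $E$. Explicitly: let $\Delta=\{(a_e,\chi_e)\}_{e\in E}$ and $\Delta'=\{(a'_e,\chi'_e)\}_{e\in E}$ be essential toric arrangements in complex tori of dimensions $r$ and $r'$, both in normal form with respect to the same $\mathcal B\subseteq E$ and the same $\mathcal A$. Suppose that there is an isomorphism of posets $\varphi:\mathscr S(\Delta)\to\mathscr S(\Delta')$ over $E$, that is, $W\subseteq H_e$ if and only if $\varphi(W)\subseteq H'_e$, for all layers $W$ and all $e\in E$. Then, for all such $I$, $c$ and $m$, one has $\sum_{i\in I}c_im_i\chi_i=0$ if and only if $\sum_{i\in I}c_im_i\chi'_i=0$. Equivalently, for all $k\in\mathbb Z^E$, one has $\sum_{e\in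 E}k_e\chi_e=0$ if and only if $\sum_{e\in E}k_e\chi'_e=0$. -/

import Mathlib

/-- The standard complex torus of dimension `r`, with its Euclidean topology.  Its character group
is `Fin r → ℤ`, written additively. -/
abbrev ComplexTorus (r : ℕ) : Type := Fin r → ℂˣ

/-- The value at `t` of the character with exponent vector `x`, i.e. the Laurent monomial
`∏ i, t i ^ x i`. -/
def torusCharacter {r : ℕ} (x : Fin r → ℤ) (t : ComplexTorus r) : ℂˣ :=
  ∏ i, t i ^ x i

/-- A toric arrangement in the torus of dimension `r`, indexed by the finite set `E`. -/
structure ToricArrangement (r : ℕ) (E : Type*) where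
  /-- The constants `a e`. -/
  a : E → ℂˣ
  /-- The characters `χ e`. -/
  χ : E → (Fin r → ℤ)

namespace ToricArrangement

variable {r : ℕ} {E : Type*}

/-- The affine hypertorus with index `e`, the zero locus of `1 - a e * χ e`. -/
def hypertorus (Δ : ToricArrangement r E) (e : E) : Set (ComplexTorus r) :=
  {t | 1 - (Δ.a e : ℂ) * (torusCharacter (Δ.χ e) t : ℂ) = 0}

/-- `W` is a layer: a connected component of an intersection of hypertori of `Δ` (the empty
intersection being the whole torus).  In particular layers are nonempty. -/
def IsLayer (Δ : ToricArrangement r E) (W : Set (ComplexTorus r)) : Prop :=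
  ∃ I : Set E, ∃ x ∈ ⋂ i ∈ I, Δ.hypertorus i, W = connectedComponentIn (⋂ i ∈ I, Δ.hypertorus i) x

/-- The set of layers. -/
def Layers (Δ : ToricArrangement r E) : Type :=
  {W : Set (ComplexTorus r) // Δ.IsLayer W}

/-- The layers are ordered by reverse inclusion. -/
instance (Δ : ToricArrangement r E) : PartialOrder Δ.Layers :=
  PartialOrder.lift (fun W => OrderDual.toDual W.1) (fun _ _ h => Subtype.ext h)

/-- The two arrangements have the same poset of layers: there is an isomorphism of posets over the
index set `E`, i.e. it respects the relation "the layer lies in the hypertorus with index `e`". -/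
def SamePosetOfLayers {r' : ℕ} (Δ : ToricArrangement r E) (Δ' : ToricArrangement r' E) : Prop :=
  ∃ φ : Δ.Layers ≃o Δ'.Layers,
    ∀ (W : Δ.Layers) (e : E), W.1 ⊆ Δ.hypertorus e ↔ (φ W).1 ⊆ Δ'.hypertorus e

/-- The sublattice `Γ` generated by the characters has maximal rank in the character group. -/
def IsEssential (Δ : ToricArrangement r E) : Prop :=
  Module.finrank ℤ (Submodule.span ℤ (Set.range Δ.χ)) = Module.finrank ℤ (Fin r → ℤ)

/-- The character `χ e` as a vector of the rational vector space `ℚ ^ r`, the character group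
tensored with `ℚ`. -/
def ratChar (Δ : ToricArrangement r E) (e : E) : Fin r → ℚ :=
  fun i => (Δ.χ e i : ℚ)

/-- The characters with index in `B` form a basis of `ℚ ^ r`. -/
structure IsBasis (Δ : ToricArrangement r E) (B : Set E) : Prop where
  linearIndependent : LinearIndependent ℚ (fun b : B => Δ.ratChar b)
  span_eq_top : ⊤ ≤ Submodule.span ℚ (Set.range (fun b : B => Δ.ratChar b))

/-- The matrix `A`: the column with index `e ∉ B` holds the coordinates of `χ e` in the basis
`(χ b)`, `b ∈ B`. -/
noncomputable def coordMatrix (Δ : ToricArrangement r E) {B : Set E} (hB : Δ.IsBasis B) :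
    Matrix B (Bᶜ : Set E) ℚ :=
  fun b e => (Module.Basis.mk hB.linearIndependent hB.span_eq_top).repr (Δ.ratChar e) b

end ToricArrangement

/-- The bipartite graph of a matrix: one vertex for each row, one for each column, and an edge
between a row and a column if the corresponding entry is nonzero. -/
def matrixGraph {R C : Type*} (A : Matrix R C ℚ) : SimpleGraph (R ⊕ C) :=
  SimpleGraph.fromRel (fun x y => ∃ i j, x = Sum.inl i ∧ y = Sum.inr j ∧ A i j ≠ 0)

/-- `F` is a maximal forest in `G`: a maximal subgraph without cycles. -/
def IsMaximalForest {V : Type*} (G F : SimpleGraph V) : Prop :=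
  Maximal (fun H : SimpleGraph V => H ≤ G ∧ H.IsAcyclic) F

namespace ToricArrangement

variable {r : ℕ} {E : Type*}

/-- `Δ` is in normal form with respect to the basis `B` and to the maximal forest `F` of the
bipartite graph of its matrix `A`: the entries of `A` on the edges of `F` are positive. -/
def IsNormalForm (Δ : ToricArrangement r E) (B : Set E)
    (F : SimpleGraph (B ⊕ (Bᶜ : Set E))) : Prop :=
  ∃ hB : Δ.IsBasis B, IsMaximalForest (matrixGraph (Δ.coordMatrix hB)) F ∧
    ∀ (b : B) (e : (Bᶜ : Set E)), F.Adj (Sum.inl b) (Sum.inr e) → 0 < Δ.coordMatrix hB b e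

/-- The linear relation `∑ i ∈ I, c i * m i * χ i = 0` holds, with signs `c i` and with positive
and relatively prime integers `m i`. -/
def IsRelation (Δ : ToricArrangement r E) (I : Finset E) (c : E → ℤˣ) (m : E → ℕ) : Prop :=
  (∀ i ∈ I, 0 < m i) ∧ I.gcd m = 1 ∧ ∑ i ∈ I, ((c i : ℤ) * (m i : ℤ)) • Δ.χ i = 0

end ToricArrangement

/-! The poset sees every maximal minor of the character matrix up to sign. If the characters `χ (f
i)` are independent, the hypertori `H (f i)` meet in exactly |det| points, and these points are the
layers below them all (`card_layersIn`). If they are dependent, either no layer lies in all the `H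
(f i)`, or two comparable ones do (`exists_lt_of_mem_layersIn`). Hence `natAbs_det_charMatrix_eq`.

Dividing by the minor of the basis `B` gives the maximal minors of `[1 | A]`, that is, all minors of
`A`, up to sign. It remains to recover signs (`eq_of_abs_minors_eq`). The forest fixes some of them.
An entry of undecided sign closes a chordless cycle with entries already known, and the minor on
that cycle has the form P + Q with P, Q nonzero. Flipping the sign of the entry gives P - Q, of a
different absolute value. So `A` is determined, and the linear relations are the integer vectors in
the kernel of `[1 | A]`. -/

/-! ### Lattice index and the exponential map -/

theorem Complex.exists_exp_eq_unit (u : ℂˣ) : ∃ z, Complex.exp z = u :=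
  ⟨_, Complex.exp_log u.ne_zero⟩

theorem Nat.card_eq_of_surjective_of_iff {α β γ : Type*} {f : α → β} {g : α → γ}
    (hf : Function.Surjective f) (hg : Function.Surjective g)
    (h : ∀ x y, f x = f y ↔ g x = g y) : Nat.card β = Nat.card γ :=
  Nat.card_congr ((Setoid.quotientKerEquivOfSurjective f hf).symm.trans
    ((Quotient.congrRight h).trans (Setoid.quotientKerEquivOfSurjective g hg)))

theorem Matrix.card_quotient_range_mulVecLin {ι : Type*} [Fintype ι] [DecidableEq ι]
    (M : Matrix ι ι ℤ) (hM : M.det ≠ 0) :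
    Nat.card ((ι → ℤ) ⧸ LinearMap.range M.mulVecLin) = M.det.natAbs := by
  have hinj : Function.Injective M.mulVecLin := by
    rw [← LinearMap.ker_eq_bot, LinearMap.ker_eq_bot']
    intro v hv
    exact Matrix.eq_zero_of_mulVec_eq_zero hM hv
  rw [← Submodule.natAbs_det_equiv _ (LinearEquiv.ofInjective M.mulVecLin hinj),
    ← LinearMap.det_toLin']
  rfl

/-- The exponential map of the complex torus. -/
noncomputable def torusExp {r : ℕ} (z : Fin r → ℂ) : ComplexTorus r :=
  fun i => Units.mk0 (Complex.exp (z i)) (Complex.exp_ne_zero _)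

theorem torusExp_surjective {r : ℕ} : Function.Surjective (torusExp (r := r)) := by
  intro t
  choose z hz using fun i => Complex.exists_exp_eq_unit (t i)
  exact ⟨z, funext fun i => Units.ext (hz i)⟩

theorem continuous_torusExp {r : ℕ} : Continuous (torusExp (r := r)) := by
  refine continuous_pi fun i => Units.isEmbedding_val₀.continuous_iff.2 ?_
  exact Complex.continuous_exp.comp (continuous_apply i)

theorem torusExp_eq_iff {r : ℕ} {z w : Fin r → ℂ} :
    torusExp z = torusExp w ↔
      ∃ n : Fin r → ℤ, ∀ i, z i = w i + n i * (2 * Real.pi * Complex.I) := by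
  rw [← Classical.skolem (p := fun i n => z i = w i + (n : ℤ) * (2 * Real.pi * Complex.I)),
    funext_iff]
  refine forall_congr' fun i => ?_
  rw [← Complex.exp_eq_exp_iff_exists_int, Units.ext_iff]
  rfl

theorem torusCharacter_torusExp {r : ℕ} (x : Fin r → ℤ) (z : Fin r → ℂ) :
    (torusCharacter x (torusExp z) : ℂ) = Complex.exp (∑ i, x i * z i) := by
  simp [torusCharacter, torusExp, Complex.exp_sum, Complex.exp_int_mul]

/-! ### Minors of the character matrix from the poset of layers -/

namespace ToricArrangement

variable {r : ℕ} {E : Type*}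

theorem torusExp_mem_hypertorus (Δ : ToricArrangement r E) {e : E} {α : ℂ}
    (hα : Complex.exp α = Δ.a e) (z : Fin r → ℂ) :
    torusExp z ∈ Δ.hypertorus e ↔
      ∃ n : ℤ, α + ∑ i, Δ.χ e i * z i = n * (2 * Real.pi * Complex.I) := by
  rw [← Complex.exp_eq_one_iff, Complex.exp_add, hα, ← torusCharacter_torusExp]
  simp only [hypertorus, Set.mem_ofPred_eq, sub_eq_zero]
  exact eq_comm

/-- The square matrix whose rows are the characters selected by `f`. -/
def charMatrix (Δ : ToricArrangement r E) (f : Fin r → E) : Matrix (Fin r) (Fin r) ℤ :=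
  Matrix.of fun i => Δ.χ (f i)

/-- In exponential coordinates the equations read `M z = 2πi n - α` with `n` an integer vector. Each
`n` has one solution `z`, and two of them give the same point of the torus exactly when the `n`
differ by an element of `M ℤ^r`, a sublattice of index |det M|. -/
theorem card_iInter_hypertorus (Δ : ToricArrangement r E) (f : Fin r → E)
    (hf : (Δ.charMatrix f).det ≠ 0) :
    Nat.card (⋂ i, Δ.hypertorus (f i)) = (Δ.charMatrix f).det.natAbs := by
  set M := Δ.charMatrix f with hM
  rw [← M.card_quotient_range_mulVecLin hf]
  set Mc : Matrix (Fin r) (Fin r) ℂ := M.map (Int.cast : ℤ → ℂ) with hMc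
  have hdet : IsUnit Mc.det := by
    have : Mc.det = (M.det : ℂ) := ((Int.castRingHom ℂ).map_det M).symm
    rw [this, isUnit_iff_ne_zero]
    exact_mod_cast hf
  choose α hα using fun i => Complex.exists_exp_eq_unit (Δ.a (f i))
  set c : ℂ := 2 * Real.pi * Complex.I with hc
  have hc0 : c ≠ 0 := Complex.two_pi_I_ne_zero
  have mem_iff : ∀ z, torusExp z ∈ (⋂ i, Δ.hypertorus (f i)) ↔
      ∃ n : Fin r → ℤ, Mc.mulVec z = fun i => n i * c - α i := by
    intro z
    simp_rw [Set.mem_iInter, Δ.torusExp_mem_hypertorus (hα _), Classical.skolem, funext_iff]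
    refine exists_congr fun n => forall_congr' fun i => ?_
    rw [eq_sub_iff_add_eq']
    rfl
  let g : (Fin r → ℤ) → (Fin r → ℂ) := fun n => Mc⁻¹.mulVec fun i => n i * c - α i
  have hg : ∀ n, Mc.mulVec (g n) = fun i => n i * c - α i := fun n => by
    simp [g, Matrix.mulVec_mulVec, Matrix.mul_nonsing_inv _ hdet]
  have hinj : Function.Injective Mc.mulVec :=
    Matrix.mulVec_injective_of_isUnit ((Matrix.isUnit_iff_isUnit_det _).2 hdet)
  have hcast : ∀ m : Fin r → ℤ, Mc.mulVec (fun i => (m i : ℂ)) = fun i => ((M.mulVec m i : ℤ) : ℂ) := by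
    intro m
    ext i
    simp [Matrix.mulVec, dotProduct, hMc]
  refine (Nat.card_eq_of_surjective_of_iff
    (f := (LinearMap.range M.mulVecLin).mkQ)
    (g := fun n => (⟨torusExp (g n), (mem_iff _).2 ⟨n, hg n⟩⟩ : (⋂ i, Δ.hypertorus (f i) : Set _)))
    (Submodule.mkQ_surjective _) ?_ ?_).symm
  · rintro ⟨t, ht⟩
    obtain ⟨z, rfl⟩ := torusExp_surjective t
    obtain ⟨n, hn⟩ := (mem_iff z).1 ht
    exact ⟨n, Subtype.ext (congrArg torusExp (hinj ((hg n).trans hn.symm)))⟩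
  · intro n n'
    simp only [Submodule.mkQ_apply, Submodule.Quotient.eq, LinearMap.mem_range, Subtype.mk.injEq,
      torusExp_eq_iff, Matrix.mulVecLin_apply]
    refine exists_congr fun m => ?_
    have : (∀ i, g n i = g n' i + m i * (2 * Real.pi * Complex.I)) ↔
        g n = g n' + c • fun i => (m i : ℂ) := by
      simp [funext_iff, mul_comm, hc]
    rw [this, ← hinj.eq_iff, Matrix.mulVec_add, Matrix.mulVec_smul, hg, hg, hcast, funext_iff,
      funext_iff]
    refine forall_congr' fun i => ?_
    simp only [Pi.add_apply, Pi.smul_apply, smul_eq_mul, Pi.sub_apply]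
    rw [← @Int.cast_inj ℂ, ← mul_right_inj' hc0]
    push_cast
    constructor <;> intro h <;> linear_combination -h

theorem finite_iInter_hypertorus (Δ : ToricArrangement r E) (f : Fin r → E)
    (hf : (Δ.charMatrix f).det ≠ 0) : (⋂ i, Δ.hypertorus (f i)).Finite := by
  refine Set.finite_coe_iff.1 (Nat.finite_of_card_ne_zero ?_)
  rw [Δ.card_iInter_hypertorus f hf]
  exact Int.natAbs_ne_zero.2 hf

/-- A connected subset of the torus with more than one point is infinite. -/
theorem Layers.eq_singleton_of_subset_finite {Δ : ToricArrangement r E}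
    {K : Set (ComplexTorus r)} (hK : K.Finite) (W : Δ.Layers) (hW : W.1 ⊆ K) :
    ∃ x, W.1 = {x} := by
  obtain ⟨_, I, x, hx, rfl⟩ := W
  refine ⟨x, Set.Subsingleton.eq_singleton_of_mem ?_ (mem_connectedComponentIn hx)⟩
  by_contra h
  exact isPreconnected_connectedComponentIn.infinite_of_nontrivial
    (Set.not_subsingleton_iff.1 h) (hK.subset hW)

/-- The layer through a point of an intersection of hypertori. -/
def layerThrough (Δ : ToricArrangement r E) (I : Set E) (x : ComplexTorus r)
    (hx : x ∈ ⋂ i ∈ I, Δ.hypertorus i) : Δ.Layers :=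
  ⟨connectedComponentIn (⋂ i ∈ I, Δ.hypertorus i) x, I, x, hx, rfl⟩

/-- The layers contained in all the hypertori selected by `f`. -/
def layersIn (Δ : ToricArrangement r E) (f : Fin r → E) : Set Δ.Layers :=
  {W | ∀ i, W.1 ⊆ Δ.hypertorus (f i)}

theorem card_layersIn (Δ : ToricArrangement r E) (f : Fin r → E)
    (hf : (Δ.charMatrix f).det ≠ 0) :
    Nat.card (Δ.layersIn f) = (Δ.charMatrix f).det.natAbs := by
  rw [← Δ.card_iInter_hypertorus f hf]
  have hfin := Δ.finite_iInter_hypertorus f hf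
  have hsub : ∀ W : Δ.layersIn f, W.1.1 ⊆ ⋂ i, Δ.hypertorus (f i) :=
    fun W => Set.subset_iInter W.2
  choose p hp using fun W : Δ.layersIn f => W.1.eq_singleton_of_subset_finite hfin (hsub W)
  refine Nat.card_congr (Equiv.ofBijective
    (fun W => ⟨p W, hsub W (hp W ▸ Set.mem_singleton _)⟩) ⟨?_, ?_⟩)
  · intro W W' h
    have h' : p W = p W' := congrArg Subtype.val h
    exact Subtype.ext (Subtype.ext ((hp W).trans (h' ▸ (hp W').symm)))
  · rintro ⟨x, hx⟩
    have hx' : x ∈ ⋂ i ∈ Set.range f, Δ.hypertorus i := by simpa using hx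
    let W : Δ.layersIn f := ⟨Δ.layerThrough (Set.range f) x hx', fun i =>
      (connectedComponentIn_subset _ _).trans (Set.biInter_subset_of_mem ⟨i, rfl⟩)⟩
    have hxW : x ∈ W.1.1 := mem_connectedComponentIn hx'
    refine ⟨W, Subtype.ext ?_⟩
    rw [hp W] at hxW
    exact hxW.symm

theorem not_lt_of_mem_layersIn (Δ : ToricArrangement r E) {f : Fin r → E}
    (hf : (Δ.charMatrix f).det ≠ 0) {W W' : Δ.Layers} (hW : W ∈ Δ.layersIn f)
    (hW' : W' ∈ Δ.layersIn f) : ¬ W < W' := by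
  intro h
  have hfin := Δ.finite_iInter_hypertorus f hf
  obtain ⟨x, hx⟩ := W.eq_singleton_of_subset_finite hfin (Set.subset_iInter hW)
  obtain ⟨y, hy⟩ := W'.eq_singleton_of_subset_finite hfin (Set.subset_iInter hW')
  have hle : W'.1 ⊆ W.1 := h.le
  refine h.ne (Subtype.ext ?_)
  rw [hx, hy, Set.singleton_subset_singleton] at hle
  rw [hx, hy, hle]

/-- A kernel vector `v` of the character matrix gives a one-parameter curve inside the intersection.
Some `χ e` is nonconstant along it, so cutting with `H e` yields a strictly smaller layer. -/
theorem exists_lt_of_mem_layersIn (Δ : ToricArrangement r E) {f : Fin r → E}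
    (hf : (Δ.charMatrix f).det = 0)
    (hspan : ∀ v : Fin r → ℤ, (∀ e, Δ.χ e ⬝ᵥ v = 0) → v = 0) {W₀ : Δ.Layers}
    (hW₀ : W₀ ∈ Δ.layersIn f) :
    ∃ W ∈ Δ.layersIn f, ∃ W' ∈ Δ.layersIn f, W < W' := by
  obtain ⟨v, hv0, hv⟩ := Matrix.exists_mulVec_eq_zero_iff.2 hf
  obtain ⟨e, he⟩ : ∃ e, Δ.χ e ⬝ᵥ v ≠ 0 := by
    by_contra! h
    exact hv0 (hspan v h)
  obtain ⟨x, hx⟩ : ∃ x, x ∈ ⋂ i ∈ Set.range f, Δ.hypertorus i := by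
    obtain ⟨W, I, x, hx, rfl⟩ := W₀
    refine ⟨x, ?_⟩
    simp only [Set.mem_range, Set.iInter_exists, Set.iInter_iInter_eq', Set.mem_iInter]
    exact fun i => hW₀ i (mem_connectedComponentIn hx)
  obtain ⟨z, rfl⟩ := torusExp_surjective x
  let γ : ℂ → ComplexTorus r := fun s => torusExp (z + s • fun i => (v i : ℂ))
  have hγ0 : γ 0 = torusExp z := by simp [γ]
  have hγ : Continuous γ := by
    refine continuous_torusExp.comp ?_
    fun_prop
  have hsum : ∀ (x : Fin r → ℤ) (s : ℂ), ∑ i, x i * (z + s • fun i => (v i : ℂ)) i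
      = ∑ i, x i * z i + s * ((x ⬝ᵥ v : ℤ) : ℂ) := by
    intro x s
    simp only [Pi.add_apply, Pi.smul_apply, smul_eq_mul, mul_add, Finset.sum_add_distrib,
      dotProduct, Int.cast_sum, Int.cast_mul, Finset.mul_sum]
    congr 1
    exact Finset.sum_congr rfl fun i _ => by ring
  obtain ⟨α, hα⟩ : ∃ α : E → ℂ, ∀ e, Complex.exp (α e) = Δ.a e := by
    choose α hα using fun e => Complex.exists_exp_eq_unit (Δ.a e)
    exact ⟨α, hα⟩
  have hmem : ∀ s, γ s ∈ ⋂ i ∈ Set.range f, Δ.hypertorus i := by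
    intro s
    simp only [Set.mem_range, Set.iInter_exists, Set.iInter_iInter_eq', Set.mem_iInter] at hx ⊢
    intro i
    have h0 : Δ.χ (f i) ⬝ᵥ v = 0 := congrFun hv i
    rw [Δ.torusExp_mem_hypertorus (hα _), hsum, h0]
    simpa using (Δ.torusExp_mem_hypertorus (hα _) z).1 (hx i)
  have hcurve : Set.range γ ⊆ connectedComponentIn (⋂ i ∈ Set.range f, Δ.hypertorus i)
      (torusExp z) :=
    (isPreconnected_range hγ).subset_connectedComponentIn ⟨0, hγ0⟩
      (Set.range_subset_iff.2 hmem)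
  have he' : ((Δ.χ e ⬝ᵥ v : ℤ) : ℂ) ≠ 0 := Int.cast_ne_zero.2 he
  have hval : ∀ u : ℂ, ∃ s : ℂ, α e + ∑ i, Δ.χ e i * (z + s • fun i => (v i : ℂ)) i = u := by
    intro u
    refine ⟨(u - α e - ∑ i, Δ.χ e i * z i) / ((Δ.χ e ⬝ᵥ v : ℤ) : ℂ), ?_⟩
    rw [hsum, div_mul_cancel₀ _ he']
    ring
  obtain ⟨s, hs⟩ := hval 0
  -- At the exponent `πi` the value of `a e * χ e` is -1, so this point of the curve is off `H e`.
  obtain ⟨s', hs'⟩ := hval (Real.pi * Complex.I)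
  have hse : γ s ∈ Δ.hypertorus e :=
    (Δ.torusExp_mem_hypertorus (hα e) _).2 ⟨0, by rw [hs]; simp⟩
  have hse' : γ s' ∉ Δ.hypertorus e := by
    intro h
    obtain ⟨n, hn⟩ := (Δ.torusExp_mem_hypertorus (hα e) _).1 h
    rw [hs'] at hn
    have := Complex.exp_eq_one_iff.2 ⟨n, hn⟩
    rw [Complex.exp_pi_mul_I] at this
    norm_num at this
  have hy : γ s ∈ ⋂ i ∈ insert e (Set.range f), Δ.hypertorus i := by
    rw [Set.biInter_insert]
    exact ⟨hse, hmem s⟩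
  have hsub : ∀ i, (⋂ i ∈ Set.range f, Δ.hypertorus i) ⊆ Δ.hypertorus (f i) :=
    fun i => Set.biInter_subset_of_mem ⟨i, rfl⟩
  have hins : (⋂ i ∈ insert e (Set.range f), Δ.hypertorus i) ⊆
      ⋂ i ∈ Set.range f, Δ.hypertorus i := by
    rw [Set.biInter_insert]
    exact Set.inter_subset_right
  refine ⟨Δ.layerThrough (Set.range f) _ hx,
    fun i => (connectedComponentIn_subset _ _).trans (hsub i),
    Δ.layerThrough (insert e (Set.range f)) _ hy,
    fun i => ((connectedComponentIn_subset _ _).trans hins).trans (hsub i), lt_of_le_of_ne ?_ ?_⟩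
  · change connectedComponentIn _ _ ⊆ connectedComponentIn _ _
    rw [connectedComponentIn_eq (hcurve ⟨s, rfl⟩)]
    exact connectedComponentIn_mono _ hins
  · intro h
    have h1 : connectedComponentIn (⋂ i ∈ Set.range f, Δ.hypertorus i) (torusExp z)
      = connectedComponentIn (⋂ i ∈ insert e (Set.range f), Δ.hypertorus i) (γ s) :=
      congrArg Subtype.val h
    have h2 := h1 ▸ hcurve ⟨s', rfl⟩
    have h3 := connectedComponentIn_subset _ _ h2
    rw [Set.biInter_insert] at h3
    exact hse' h3.1

/-- Equal counts settle the case of two nonzero determinants. If just one vanishes, the nonzero one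
supplies a layer; its image lies in a dependent intersection, which contains a strict pair of
layers, and this pair transfers back to an antichain. -/
theorem natAbs_det_charMatrix_eq {Δ Δ' : ToricArrangement r E}
    (hspan : ∀ v : Fin r → ℤ, (∀ e, Δ.χ e ⬝ᵥ v = 0) → v = 0)
    (hspan' : ∀ v : Fin r → ℤ, (∀ e, Δ'.χ e ⬝ᵥ v = 0) → v = 0)
    (hS : Δ.SamePosetOfLayers Δ') (f : Fin r → E) :
    (Δ.charMatrix f).det.natAbs = (Δ'.charMatrix f).det.natAbs := by
  obtain ⟨φ, hφ⟩ := hS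
  have hmem : ∀ W, W ∈ Δ.layersIn f ↔ φ W ∈ Δ'.layersIn f :=
    fun W => forall_congr' fun i => hφ W (f i)
  have hmem' : ∀ W, W ∈ Δ'.layersIn f ↔ φ.symm W ∈ Δ.layersIn f := fun W => by
    rw [hmem, φ.apply_symm_apply]
  have hcard : Nat.card (Δ.layersIn f) = Nat.card (Δ'.layersIn f) :=
    Nat.card_congr (φ.toEquiv.subtypeEquiv hmem)
  by_cases h : (Δ.charMatrix f).det = 0 <;> by_cases h' : (Δ'.charMatrix f).det = 0
  · rw [h, h']
  · exfalso
    have hne : Nonempty (Δ'.layersIn f) := by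
      refine (Nat.card_ne_zero.1 ?_).1
      rw [Δ'.card_layersIn f h']
      exact Int.natAbs_ne_zero.2 h'
    obtain ⟨W₀, hW₀⟩ := hne
    obtain ⟨W, hW, W', hW', hlt⟩ := Δ.exists_lt_of_mem_layersIn h hspan ((hmem' W₀).1 hW₀)
    exact Δ'.not_lt_of_mem_layersIn h' ((hmem W).1 hW) ((hmem W').1 hW') (φ.lt_iff_lt.2 hlt)
  · exfalso
    have hne : Nonempty (Δ.layersIn f) := by
      refine (Nat.card_ne_zero.1 ?_).1
      rw [Δ.card_layersIn f h]
      exact Int.natAbs_ne_zero.2 h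
    obtain ⟨W₀, hW₀⟩ := hne
    obtain ⟨W, hW, W', hW', hlt⟩ := Δ'.exists_lt_of_mem_layersIn h' hspan' ((hmem W₀).1 hW₀)
    exact Δ.not_lt_of_mem_layersIn h ((hmem' W).1 hW) ((hmem' W').1 hW')
      (φ.symm.lt_iff_lt.2 hlt)
  · rw [← Δ.card_layersIn f h, ← Δ'.card_layersIn f h', hcard]

end ToricArrangement

/-! ### Chordless cycles and the recovery of signs -/

/-- Only the first and last entries of row 0 can be nonzero. In the Laplace expansion their cofactor
matrices are lower and upper triangular respectively. -/
theorem Matrix.det_of_cyclic_support {K : Type*} [CommRing K] {n : ℕ}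
    (M : Matrix (Fin (n + 2)) (Fin (n + 2)) K)
    (h : ∀ i j : Fin (n + 2), M i j ≠ 0 → j = i ∨ (i : ℕ) = j + 1 ∨ (i = 0 ∧ j = Fin.last _)) :
    M.det = ∏ i, M i i +
      (-1) ^ (n + 1) * M 0 (Fin.last _) * ∏ i : Fin (n + 1), M i.succ i.castSucc := by
  have h' : ∀ i j : Fin (n + 2), ¬ (j = i ∨ (i : ℕ) = j + 1 ∨ (i = 0 ∧ j = Fin.last _)) → M i j = 0 :=
    fun i j hij => not_not.1 fun h0 => hij (h i j h0)
  rw [Matrix.det_succ_row_zero, Fin.sum_univ_succ, Fin.sum_univ_castSucc,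
    Finset.sum_eq_zero (s := Finset.univ) (f := fun i : Fin n => _)]
  · have h1 : (M.submatrix Fin.succ (Fin.succAbove 0)).det = ∏ i : Fin (n + 1), M i.succ i.succ := by
      rw [Matrix.det_of_isLowerTriangular]
      · simp
      · intro i j hij
        rw [OrderDual.toDual_lt_toDual] at hij
        refine h' _ _ ?_
        simp only [Fin.zero_succAbove, Fin.ext_iff, Fin.val_succ, Fin.val_last, Fin.val_zero]
        have : (i : ℕ) < j := hij
        omega
    have h2 : (M.submatrix Fin.succ (Fin.succAbove (Fin.last n).succ)).det
        = ∏ i : Fin (n + 1), M i.succ i.castSucc := by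
      rw [Fin.succ_last, Matrix.det_of_isUpperTriangular]
      · simp
      · intro i j hij
        refine h' _ _ ?_
        simp only [Fin.succAbove_last, Fin.ext_iff, Fin.val_succ, Fin.val_last, Fin.val_zero,
          Fin.val_castSucc]
        have : (j : ℕ) < i := hij
        omega
    rw [h1, h2, Fin.prod_univ_succ (fun i => M i i)]
    simp
  · intro j _
    rw [h' 0 j.castSucc.succ]
    · simp
    · simp only [Fin.ext_iff, Fin.val_succ, Fin.val_last, Fin.val_zero, Fin.val_castSucc]
      omega

namespace SimpleGraph

variable {V : Type*} {G : SimpleGraph V} {u v : V}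

theorem Walk.dist_getVert_le (p : G.Walk u v) {k l : ℕ} (hkl : k ≤ l) :
    G.dist (p.getVert k) (p.getVert l) ≤ l - k := by
  have h := dist_le ((p.drop k).take (l - k))
  rw [Walk.take_length, Walk.drop_getVert, Nat.add_sub_cancel' hkl] at h
  exact h.trans (min_le_left _ _)

theorem Walk.dist_le_of_chord (p : G.Walk u v) {k l : ℕ}
    (h : G.Adj (p.getVert k) (p.getVert l)) :
    G.dist u v ≤ k + 1 + (p.length - l) := by
  refine (dist_le ((p.take k).append (Walk.cons h (p.drop l)))).trans ?_
  rw [Walk.length_append, Walk.length_cons, Walk.take_length, Walk.drop_length]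
  have := min_le_left k p.length
  omega

end SimpleGraph

theorem matrixGraph_adj_inl_inr {R C : Type*} {A : Matrix R C ℚ} {i : R} {j : C} :
    (matrixGraph A).Adj (Sum.inl i) (Sum.inr j) ↔ A i j ≠ 0 := by
  simp [matrixGraph, SimpleGraph.fromRel_adj]

theorem matrixGraph_adj_isLeft {R C : Type*} {A : Matrix R C ℚ} {x y : R ⊕ C}
    (h : (matrixGraph A).Adj x y) : x.isLeft = !y.isLeft := by
  obtain ⟨_, ⟨i, j, rfl, rfl, _⟩ | ⟨i, j, rfl, rfl, _⟩⟩ := (SimpleGraph.fromRel_adj _ _ _).1 h <;> rfl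

/-- The entries of `A` where it agrees with `A'`; the other entries are replaced by zero. -/
noncomputable def Matrix.agreement {R C : Type*} (A A' : Matrix R C ℚ) : Matrix R C ℚ :=
  open Classical in fun i j => if A i j = A' i j then A i j else 0

theorem Matrix.agreement_ne_zero_iff {R C : Type*} {A A' : Matrix R C ℚ} {i : R} {j : C} :
    A.agreement A' i j ≠ 0 ↔ A i j = A' i j ∧ A i j ≠ 0 := by
  simp [Matrix.agreement]

/-- The induction is on the distance between row and column in the graph `D` of the nonzero entries
where `A` and `A'` agree. A geodesic in `D` together with a disagreeing entry forms a cycle without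
chords in the graph of `A`. -/
theorem eq_of_abs_minors_eq {R C : Type*} {A A' : Matrix R C ℚ} {F : SimpleGraph (R ⊕ C)}
    (hF : IsMaximalForest (matrixGraph A) F)
    (hminor : ∀ (k : ℕ) (b : Fin k → R) (c : Fin k → C), Function.Injective b →
      |(A.submatrix b c).det| = |(A'.submatrix b c).det|)
    (hAF : ∀ i j, F.Adj (Sum.inl i) (Sum.inr j) → A i j = A' i j) : A = A' := by
  have habs : ∀ i j, |A i j| = |A' i j| := by
    intro i j
    simpa using hminor 1 (fun _ => i) (fun _ => j) (Function.injective_of_subsingleton _)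
  set D := matrixGraph (A.agreement A') with hD
  have hFD : F ≤ D := by
    intro x y hxy
    have hG := hF.prop.1 hxy
    obtain ⟨_, ⟨i, j, rfl, rfl, h⟩ | ⟨i, j, rfl, rfl, h⟩⟩ := (SimpleGraph.fromRel_adj _ _ _).1 hG
    · exact matrixGraph_adj_inl_inr.2 (Matrix.agreement_ne_zero_iff.2 ⟨hAF i j hxy, h⟩)
    · exact (matrixGraph_adj_inl_inr.2
        (Matrix.agreement_ne_zero_iff.2 ⟨hAF i j hxy.symm, h⟩)).symm
  -- Vertices in different components also have distance 0. This is harmless: a disagreeing entry is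
  -- nonzero, and the maximal forest, contained in `D`, connects its row and column.
  suffices H : ∀ d i j, D.dist (Sum.inl i) (Sum.inr j) = d → A i j = A' i j by
    ext i j
    exact H _ i j rfl
  intro d
  induction d using Nat.strong_induction_on with
  | _ d ih =>
  intro i j hd
  by_contra hne
  have hneg : A' i j = - A i j := by
    rcases abs_eq_abs.1 (habs i j) with h | h
    · exact absurd h hne
    · rw [h, neg_neg]
  have hA0 : A i j ≠ 0 := fun h => hne (by rw [hneg, h, neg_zero])
  have hreach : D.Reachable (Sum.inl i) (Sum.inr j) := by
    have h1 : (matrixGraph A).Reachable (Sum.inl i) (Sum.inr j) :=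
      (matrixGraph_adj_inl_inr.2 hA0).reachable
    rw [← SimpleGraph.reachable_eq_of_maximal_isAcyclic F hF] at h1
    exact h1.mono hFD
  obtain ⟨p, hp, hlen⟩ := hreach.exists_path_of_dist
  have hside : ∀ k ≤ p.length, (p.getVert k).isLeft = decide (Even k) := by
    intro k
    induction k with
    | zero => simp
    | succ k ihk =>
      intro hk
      have h1 := matrixGraph_adj_isLeft (p.adj_getVert_succ hk)
      rw [ihk (by omega)] at h1
      have h2 := congrArg (!·) h1
      simp only [Bool.not_not] at h2
      rw [← h2]
      simp only [Nat.even_add_one, decide_not]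
  have hodd : ¬ Even p.length := by
    have := hside _ le_rfl
    simpa using this
  obtain ⟨m, hm⟩ := Nat.not_even_iff_odd.1 hodd
  obtain ⟨n, rfl⟩ : ∃ n, m = n + 1 := by
    refine Nat.exists_eq_succ_of_ne_zero ?_
    rintro rfl
    have h1 := p.adj_getVert_succ (i := 0) (by omega)
    have h2 : p.getVert 1 = Sum.inr j := by
      have := p.getVert_length
      rwa [hm] at this
    rw [p.getVert_zero, zero_add, h2] at h1
    exact hne (Matrix.agreement_ne_zero_iff.1 (matrixGraph_adj_inl_inr.1 h1)).1
  -- The path has length `2 * n + 3`. Its even vertices are the rows and its odd vertices the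
  -- columns of a square submatrix of size `n + 2`, with the entry at `i`, `j` in the upper right
  -- corner.
  have hb : ∀ s : Fin (n + 2), ∃ b, p.getVert (2 * s) = Sum.inl b := by
    intro s
    refine Sum.isLeft_iff.1 ?_
    rw [hside _ (by omega)]
    simp
  have hc : ∀ t : Fin (n + 2), ∃ c, p.getVert (2 * t + 1) = Sum.inr c := by
    intro t
    refine Sum.isRight_iff.1 ?_
    rw [← Sum.not_isLeft, hside _ (by omega)]
    simp
  choose b hb using hb
  choose c hc using hc
  have hbinj : Function.Injective b := by
    intro s s' h
    have h1 : p.getVert (2 * s) = p.getVert (2 * s') := by rw [hb, hb, h]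
    have h2 := hp.getVert_injOn (by simp only [Set.mem_ofPred_eq]; omega)
      (by simp only [Set.mem_ofPred_eq]; omega) h1
    exact Fin.ext (by omega)
  have hb0 : b 0 = i := by
    have := hb 0
    simpa using this.symm
  have hclast : c (Fin.last _) = j := by
    have h1 := hc (Fin.last _)
    have h2 := p.getVert_length
    rw [hm] at h2
    rw [Fin.val_last, h2] at h1
    exact (Sum.inr_injective h1).symm
  have hdiag : ∀ s, A (b s) (c s) = A' (b s) (c s) ∧ A (b s) (c s) ≠ 0 := by
    intro s
    have h1 := p.adj_getVert_succ (i := 2 * s) (by omega)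
    rw [hb, hc] at h1
    exact Matrix.agreement_ne_zero_iff.1 (matrixGraph_adj_inl_inr.1 h1)
  have hsub : ∀ s : Fin (n + 1), A (b s.succ) (c s.castSucc) = A' (b s.succ) (c s.castSucc) ∧
      A (b s.succ) (c s.castSucc) ≠ 0 := by
    intro s
    have h1 := p.adj_getVert_succ (i := 2 * s + 1) (by omega)
    have h2 := hb s.succ
    have h3 := hc s.castSucc
    rw [Fin.val_castSucc] at h3
    rw [Fin.val_succ, mul_add] at h2
    rw [h3, h2] at h1
    exact Matrix.agreement_ne_zero_iff.1 (matrixGraph_adj_inl_inr.1 h1.symm)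
  -- Any other nonzero entry would be a chord. If `A` and `A'` agree there, it shortens the
  -- geodesic; if not, its ends are closer than `d` along the path, contradicting the induction
  -- hypothesis.
  have hsupp : ∀ s t, A (b s) (c t) ≠ 0 →
      t = s ∨ (s : ℕ) = t + 1 ∨ (s = 0 ∧ t = Fin.last _) := by
    intro s t h0
    by_contra! hcon
    obtain ⟨hc1, hc2, hc3⟩ := hcon
    simp only [Ne, Fin.ext_iff, Fin.val_zero, Fin.val_last] at hc1 hc2 hc3
    by_cases hag : A (b s) (c t) = A' (b s) (c t)
    · have hadj : D.Adj (p.getVert (2 * s)) (p.getVert (2 * t + 1)) := by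
        rw [hb, hc]
        exact matrixGraph_adj_inl_inr.2 (Matrix.agreement_ne_zero_iff.2 ⟨hag, h0⟩)
      have h1 := p.dist_le_of_chord hadj
      have h2 := p.dist_le_of_chord hadj.symm
      omega
    · refine hag (ih _ ?_ _ _ rfl)
      rw [← hb, ← hc]
      rcases le_total (2 * (s : ℕ)) (2 * t + 1) with hle | hle
      · have := p.dist_getVert_le hle
        omega
      · have := p.dist_getVert_le hle
        rw [SimpleGraph.dist_comm] at this
        omega
  have hzero : ∀ s t, A' (b s) (c t) ≠ 0 → A (b s) (c t) ≠ 0 := by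
    intro s t h
    rwa [← abs_ne_zero, habs, abs_ne_zero]
  have hdet := (A.submatrix b c).det_of_cyclic_support hsupp
  have hdet' := (A'.submatrix b c).det_of_cyclic_support fun s t h => hsupp s t (hzero s t h)
  simp only [Matrix.submatrix_apply, hb0, hclast] at hdet hdet'
  rw [hneg] at hdet'
  simp only [← (hdiag _).1, ← (hsub _).1] at hdet'
  have key := hminor _ b c hbinj
  have hP : ∏ s, A (b s) (c s) ≠ 0 := Finset.prod_ne_zero_iff.2 fun s _ => (hdiag s).2
  have hQ : (-1) ^ (n + 1) * A i j * ∏ s : Fin (n + 1), A (b s.succ) (c s.castSucc) ≠ 0 :=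
    mul_ne_zero (mul_ne_zero (pow_ne_zero _ (by norm_num)) hA0)
      (Finset.prod_ne_zero_iff.2 fun s _ => (hsub s).2)
  rw [hdet, hdet'] at key
  -- From |P + Q| = |P - Q| it follows that Q = 0 or P = 0.
  rcases abs_eq_abs.1 key with h | h
  · exact hQ (by linarith)
  · exact hP (by linarith)

/-! ### Coordinates in a basis and the main theorem -/

/-- This turns arbitrary minors into maximal ones: the columns outside the range of `b` remain unit
vectors, so the matrix is block triangular with an identity block. -/
theorem Matrix.det_submatrix_extend {R E : Type*} [Fintype R] [DecidableEq R]
    (M : Matrix R E ℚ) {v : R → E} (hv : M.submatrix id v = 1) {k : ℕ} {b : Fin k → R}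
    (hb : Function.Injective b) (c : Fin k → E) :
    (M.submatrix id (Function.extend b c v)).det = (M.submatrix b c).det := by
  classical
  have hMv : ∀ x y, M x (v y) = (1 : Matrix R R ℚ) x y := fun x y => congrFun (congrFun hv x) y
  have hout : ∀ y, (¬ ∃ i, b i = y) → Function.extend b c v y = v y := fun y hy =>
    Function.extend_apply' _ _ _ hy
  rw [Matrix.twoBlockTriangular_det' _ (fun y => ∃ i, b i = y)]
  · have h1 : (M.submatrix id (Function.extend b c v)).toSquareBlockProp (fun y => ¬ ∃ i, b i = y) = 1 := by
      ext x y
      rw [Matrix.toSquareBlockProp_def, Matrix.of_apply, Matrix.submatrix_apply, hout _ y.2, hMv,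
        id, Matrix.one_apply, Matrix.one_apply]
      simp only [Subtype.ext_iff]
    obtain ⟨e, he⟩ : ∃ e : Fin k ≃ {y // ∃ i, b i = y}, ∀ i, (e i : R) = b i :=
      ⟨Equiv.ofInjective b hb, fun _ => rfl⟩
    rw [h1, Matrix.det_one, mul_one, ← Matrix.det_submatrix_equiv_self e]
    congr 1
    ext x y
    simp [Matrix.toSquareBlockProp_def, he, hb.extend_apply]
  · intro x hx y hy
    rw [Matrix.submatrix_apply, hout y hy, hMv, id, Matrix.one_apply_ne]
    rintro rfl
    exact hy hx

namespace ToricArrangement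

variable {r : ℕ} {E : Type*} {Δ : ToricArrangement r E} {B : Set E}

/-- The basis of the rational vector space `ℚ ^ r` consisting of the characters in `B`. -/
noncomputable def IsBasis.basis (hB : Δ.IsBasis B) : Module.Basis B ℚ (Fin r → ℚ) :=
  Module.Basis.mk hB.linearIndependent hB.span_eq_top

/-- The coordinates of all the characters in the basis `B`. -/
noncomputable def IsBasis.fullMatrix (hB : Δ.IsBasis B) : Matrix B E ℚ :=
  fun b e => hB.basis.repr (Δ.ratChar e) b

theorem IsBasis.fullMatrix_submatrix_val [DecidableEq B] (hB : Δ.IsBasis B) :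
    hB.fullMatrix.submatrix id (Subtype.val : B → E) = 1 := by
  ext x y
  have : Δ.ratChar y = hB.basis y := by rw [IsBasis.basis, Module.Basis.mk_apply]
  rw [Matrix.submatrix_apply, IsBasis.fullMatrix, this, Module.Basis.repr_self, id,
    Matrix.one_apply, Finsupp.single_apply]
  simp only [eq_comm]

theorem IsBasis.card_eq [Fintype B] (hB : Δ.IsBasis B) : Fintype.card B = r := by
  rw [← Module.finrank_eq_card_basis hB.basis, Module.finrank_fin_fun]

theorem IsBasis.ratChar_eq_sum [Fintype B] (hB : Δ.IsBasis B) (e : E) :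
    Δ.ratChar e = ∑ b, hB.fullMatrix b e • Δ.ratChar b := by
  conv_lhs => rw [← hB.basis.sum_repr (Δ.ratChar e)]
  refine Finset.sum_congr rfl fun b _ => ?_
  rw [IsBasis.basis, Module.Basis.mk_apply]
  rfl

theorem IsBasis.det_charMatrix_ne_zero (hB : Δ.IsBasis B) (σ : Fin r ≃ B) :
    (Δ.charMatrix fun i => σ i).det ≠ 0 := by
  have hli : LinearIndependent ℚ fun i => Δ.ratChar (σ i) :=
    hB.linearIndependent.comp σ σ.injective
  have hunit : IsUnit ((Δ.charMatrix fun i => σ i).map (Int.cast : ℤ → ℚ)) :=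
    Matrix.linearIndependent_rows_iff_isUnit.1 hli
  have hdet := ((Matrix.isUnit_iff_isUnit_det _).1 hunit).ne_zero
  have hcast : ((Δ.charMatrix fun i => σ i).map (Int.cast : ℤ → ℚ)).det =
      ((Δ.charMatrix fun i => σ i).det : ℚ) := ((Int.castRingHom ℚ).map_det _).symm
  rw [hcast] at hdet
  exact_mod_cast hdet

theorem IsBasis.eq_zero_of_dotProduct (hB : Δ.IsBasis B) (σ : Fin r ≃ B) (v : Fin r → ℤ)
    (hv : ∀ e, Δ.χ e ⬝ᵥ v = 0) : v = 0 :=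
  Matrix.eq_zero_of_mulVec_eq_zero (hB.det_charMatrix_ne_zero σ) (funext fun i => hv (σ i))

/-- Change of basis: each selected character is the combination of the basis characters given by a
column of `fullMatrix`. -/
theorem IsBasis.det_charMatrix_eq [Fintype B] [DecidableEq B] (hB : Δ.IsBasis B) (σ : Fin r ≃ B)
    (f : B → E) :
    ((Δ.charMatrix fun i => f (σ i)).det : ℚ) =
      (hB.fullMatrix.submatrix id f).det * (Δ.charMatrix fun i => σ i).det := by
  have hcast : ∀ M : Matrix (Fin r) (Fin r) ℤ, (M.det : ℚ) = (M.map (Int.cast : ℤ → ℚ)).det :=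
    (Int.castRingHom ℚ).map_det
  rw [hcast, hcast, ← Matrix.det_transpose (hB.fullMatrix.submatrix id f),
    ← Matrix.det_submatrix_equiv_self σ, ← Matrix.det_mul]
  congr 1
  ext i j
  have h := congrFun (hB.ratChar_eq_sum (f (σ i))) j
  rw [Finset.sum_apply, ← σ.sum_comp] at h
  exact h

theorem IsBasis.sum_smul_eq_zero_iff (hB : Δ.IsBasis B) (s : Finset E) (k : E → ℤ) :
    ∑ e ∈ s, k e • Δ.χ e = 0 ↔ ∀ b, ∑ e ∈ s, (k e : ℚ) * hB.fullMatrix b e = 0 := by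
  have h1 : ∑ e ∈ s, k e • Δ.χ e = 0 ↔ ∑ e ∈ s, (k e : ℚ) • Δ.ratChar e = 0 := by
    rw [funext_iff, funext_iff]
    refine forall_congr' fun i => ?_
    simp only [Finset.sum_apply, Pi.smul_apply, smul_eq_mul, Pi.zero_apply, ratChar]
    exact_mod_cast Iff.rfl
  rw [h1, ← hB.basis.repr.map_eq_zero_iff, Finsupp.ext_iff]
  refine forall_congr' fun b => ?_
  simp [IsBasis.fullMatrix, map_sum]

theorem IsBasis.fullMatrix_eq_of_coordMatrix_eq {r' : ℕ} {Δ' : ToricArrangement r' E}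
    (hB : Δ.IsBasis B) (hB' : Δ'.IsBasis B) (h : Δ.coordMatrix hB = Δ'.coordMatrix hB') :
    hB.fullMatrix = hB'.fullMatrix := by
  classical
  ext b e
  by_cases he : e ∈ B
  · have h1 := hB.fullMatrix_submatrix_val.trans hB'.fullMatrix_submatrix_val.symm
    exact congrFun (congrFun h1 b) ⟨e, he⟩
  · exact congrFun (congrFun h b) ⟨e, he⟩

theorem coordMatrix_eq_of_samePosetOfLayers [Finite E] {Δ' : ToricArrangement r E}
    {F : SimpleGraph (B ⊕ (Bᶜ : Set E))} (hB : Δ.IsBasis B) (hB' : Δ'.IsBasis B)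
    (hF : IsMaximalForest (matrixGraph (Δ.coordMatrix hB)) F)
    (hpos : ∀ (b : B) (e : (Bᶜ : Set E)), F.Adj (Sum.inl b) (Sum.inr e) →
      0 < Δ.coordMatrix hB b e)
    (hpos' : ∀ (b : B) (e : (Bᶜ : Set E)), F.Adj (Sum.inl b) (Sum.inr e) →
      0 < Δ'.coordMatrix hB' b e)
    (hS : Δ.SamePosetOfLayers Δ') : Δ.coordMatrix hB = Δ'.coordMatrix hB' := by
  classical
  have := Fintype.ofFinite B
  let σ : Fin r ≃ B := (Fintype.equivFinOfCardEq hB.card_eq).symm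
  have habs : ∀ f : Fin r → E,
      |((Δ.charMatrix f).det : ℚ)| = |((Δ'.charMatrix f).det : ℚ)| := by
    intro f
    have h := natAbs_det_charMatrix_eq (hB.eq_zero_of_dotProduct σ)
      (hB'.eq_zero_of_dotProduct σ) hS f
    rw [← Int.cast_abs, ← Int.cast_abs, Int.abs_eq_natAbs, Int.abs_eq_natAbs, h]
  have hfull : ∀ f : B → E, |(hB.fullMatrix.submatrix id f).det| =
      |(hB'.fullMatrix.submatrix id f).det| := by
    intro f
    have h := habs fun i => f (σ i)
    -- The minor of `B` itself has the same absolute value for both arrangements, so it cancels.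
    rw [hB.det_charMatrix_eq, hB'.det_charMatrix_eq, abs_mul, abs_mul, habs fun i => σ i] at h
    exact mul_right_cancel₀
      (abs_ne_zero.2 (Int.cast_ne_zero.2 (hB'.det_charMatrix_ne_zero σ))) h
  have hminor : ∀ (k : ℕ) (b : Fin k → B) (c : Fin k → (Bᶜ : Set E)), Function.Injective b →
      |((Δ.coordMatrix hB).submatrix b c).det| = |((Δ'.coordMatrix hB').submatrix b c).det| := by
    intro k b c hb
    have h := hfull (Function.extend b (fun i => (c i : E)) Subtype.val)
    rw [Matrix.det_submatrix_extend _ hB.fullMatrix_submatrix_val hb,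
      Matrix.det_submatrix_extend _ hB'.fullMatrix_submatrix_val hb] at h
    exact h
  refine eq_of_abs_minors_eq hF hminor fun b e hbe => ?_
  have h := hminor 1 (fun _ => b) (fun _ => e) (Function.injective_of_subsingleton _)
  simp only [Matrix.det_unique, Matrix.submatrix_apply] at h
  rwa [abs_of_pos (hpos b e hbe), abs_of_pos (hpos' b e hbe)] at h

end ToricArrangement

theorem mainTheorem7 {E : Type*} [Fintype E] (r r' : ℕ)
    (Δ : ToricArrangement r E) (Δ' : ToricArrangement r' E)
    (hΔ : Δ.IsEssential) (hΔ' : Δ'.IsEssential)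
    (B : Set E) (F : SimpleGraph (B ⊕ (Bᶜ : Set E)))
    (hN : Δ.IsNormalForm B F) (hN' : Δ'.IsNormalForm B F)
    (hS : Δ.SamePosetOfLayers Δ') :
    (∀ (I : Finset E) (c : E → ℤˣ) (m : E → ℕ), Δ.IsRelation I c m ↔ Δ'.IsRelation I c m) ∧
      ∀ k : E → ℤ, ∑ e, k e • Δ.χ e = 0 ↔ ∑ e, k e • Δ'.χ e = 0 := by
  classical
  obtain ⟨hB, hF, hpos⟩ := hN
  obtain ⟨hB', -, hpos'⟩ := hN'
  have := Fintype.ofFinite B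
  obtain rfl : r = r' := hB.card_eq.symm.trans hB'.card_eq
  have hA := ToricArrangement.coordMatrix_eq_of_samePosetOfLayers hB hB' hF hpos hpos' hS
  have key : ∀ (s : Finset E) (k : E → ℤ),
      ∑ e ∈ s, k e • Δ.χ e = 0 ↔ ∑ e ∈ s, k e • Δ'.χ e = 0 := by
    intro s k
    rw [hB.sum_smul_eq_zero_iff, hB'.sum_smul_eq_zero_iff,
      hB.fullMatrix_eq_of_coordMatrix_eq hB' hA]
  exact ⟨fun I c m => and_congr_right' (and_congr_right' (key I _)), key Finset.univ⟩
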